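/- **Theorem 5.3.** Let $N\ge 1$. All functions are real-valued. For an open set $\Omega\subseteq\mathbb R^N$, $H^1_0(\Omega)$ is the closure of $C_c^\infty(\Omega)$ in $H^1(\Omega)$, and $H(\Delta,\Omega)$ is the space of all $u\in L^2(\Omega)$ whose distributional Laplacian $\Delta u$ belongs to $L^2(\Omega)$. For a bounded domain $\Omega$ and $f\in H^1(\Omega)$, a *weak solution* of the Navier problem $$\Delta^2u=0\ \text{ in }\Omega,\qquad u=0\ \text{ on }\partial\Omega,\qquad \Delta u=f\ \text{ on }\partial\Omega$$ is a function $u\in H(\Delta,\Omega)\cap H^1_0(\Omega)$ such that $$\int_\Omega \Delta u\,\Delta\varphi\,dx=\int_\Omega\bigl(f\,\Delta\varphi+\nabla f\cdot\nabla\varphi\bigr)\,dx\qquad\text{for all }\varphi\in H(\Delta,\Omega)\cap H^1_0(\Omega).$$ Let $D\subset\mathbb R^N$ be a fixed bounded set, and let $\Omega$ and $\Omega_\varepsilon$ ($\varepsilon>0$) be domains (non-empty connected open sets) contained in $D$. Assume that: 1. $\Omega_\varepsilon$ converges compactly to $\Omega$ as $\varepsilon\to0$, that is, for every compact $K\subset\Omega$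 there is $\varepsilon_K>0$ with $K\subset\Omega_\varepsilon$ for all $\varepsilon\in(0,\varepsilon_K)$, and for every compact $K\subset\mathbb R^N\setminus\overline\Omega$ there is $\varepsilon_K>0$ with $K\subset\mathbb R^N\setminus\overline{\Omega_\varepsilon}$ for all $\varepsilon\in(0,\varepsilon_K)$; 2. $\Omega$ is stable, that is, every function in $H^1(\mathbb R^N)$ vanishing almost everywhere on $\mathbb R^N\setminus\overline\Omega$ belongs to $H^1_0(\Omega)$, where $H^1_0(\Omega)$ is regarded as a subspace of $H^1(\mathbb R^N)$ through extension by zero. Let $f\in H^1(\Omega)$ and $f_\varepsilon\in H^1(\Omega_\varepsilon)$ satisfy $$\|f_\varepsilon-f_0\|_{L^2(\Omega_\varepsilon)}\to0,\qquad \|\nabla f_\varepsilon-(\nabla f)_0\|_{L^2(\Omega_\varepsilon)}\to0\qquad\text{as }\varepsilon\to0,$$ where $v_0$ denotes the extension of $v$ by zero outside its domain of definition. Let $u$ be the weak solution of the Navier problem in $\Omega$ with datum $f$, and let $u_\varepsilon$ be the weak solution of the Navier problem in $\Omega_\varepsilon$ with datum $f_\varepsilon$. Then, as $\varepsilon\to0$,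 $$\|u_\varepsilon-u_0\|_{L^2(\Omega_\varepsilon)}\to0,\qquad \|\nabla u_\varepsilon-(\nabla u)_0\|_{L^2(\Omega_\varepsilon)}\to0,\qquad \|\Delta u_\varepsilon-(\Delta u)_0\|_{L^2(\Omega_\varepsilon)}\to0 .$$ -/

import Mathlib

open MeasureTheory Filter Topology
open scoped ContDiff

noncomputable section

namespace NavierProblem

/-- The space `ℝ^N` with its Euclidean norm. -/
abbrev Space (N : ℕ) : Type := EuclideanSpace ℝ (Fin N)

variable {N : ℕ}

/-- A domain: a nonempty, open and connected set. -/
def IsDomainSet (Ω : Set (Space N)) : Prop := IsOpen Ω ∧ IsConnected Ω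

/-- `φ ∈ C_c^∞(Ω)`; the function is regarded as defined on the whole space. -/
def IsTestFunction (Ω : Set (Space N)) (φ : Space N → ℝ) : Prop :=
  ContDiff ℝ ∞ φ ∧ HasCompactSupport φ ∧ tsupport φ ⊆ Ω

/-- `v ∈ L²(Ω)`, for scalar or vector functions. Functions on `Ω` are represented by functions on
the whole space whose values outside `Ω` play no role. -/
def MemL2 {F : Type*} [NormedAddCommGroup F] (Ω : Set (Space N)) (v : Space N → F) : Prop :=
  MemLp v 2 (volume.restrict Ω)

/-- The norm of `L²(Ω)`, with values in `[0, ∞]`. -/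
def normL2 {F : Type*} [NormedAddCommGroup F] (Ω : Set (Space N)) (v : Space N → F) : ENNReal :=
  eLpNorm v 2 (volume.restrict Ω)

/-- `g ∈ L²(Ω)^N` is the weak gradient of `u` in `Ω`. -/
def IsWeakGradient (Ω : Set (Space N)) (u : Space N → ℝ) (g : Space N → Space N) : Prop :=
  MemL2 Ω g ∧ ∀ φ : Space N → ℝ, IsTestFunction Ω φ → ∀ i : Fin N,
    ∫ x in Ω, u x * gradient φ x i = -∫ x in Ω, g x i * φ x

/-- `v ∈ L²(Ω)` is the distributional Laplacian of `u` in `Ω`. -/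
def IsWeakLaplacian (Ω : Set (Space N)) (u v : Space N → ℝ) : Prop :=
  MemL2 Ω v ∧ ∀ φ : Space N → ℝ, IsTestFunction Ω φ →
    ∫ x in Ω, u x * Laplacian.laplacian φ x = ∫ x in Ω, v x * φ x

/-- `u ∈ H¹(Ω)`. -/
def MemH1 (Ω : Set (Space N)) (u : Space N → ℝ) : Prop :=
  MemL2 Ω u ∧ ∃ g, IsWeakGradient Ω u g

/-- `u ∈ H(Δ, Ω)`: both `u` and its distributional Laplacian belong to `L²(Ω)`. -/
def MemHLaplacian (Ω : Set (Space N)) (u : Space N → ℝ) : Prop :=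
  MemL2 Ω u ∧ ∃ v, IsWeakLaplacian Ω u v

open Classical in
/-- The weak gradient `∇u` of a function `u ∈ H¹(Ω)` (unique up to null sets of `Ω`). -/
def weakGradient (Ω : Set (Space N)) (u : Space N → ℝ) : Space N → Space N :=
  if h : ∃ g, IsWeakGradient Ω u g then h.choose else 0

open Classical in
/-- The distributional Laplacian `Δu` of a function `u ∈ H(Δ, Ω)` (unique up to null sets
of `Ω`). -/
def weakLaplacian (Ω : Set (Space N)) (u : Space N → ℝ) : Space N → ℝ :=
  if h : ∃ v, IsWeakLaplacian Ω u v then h.choose else 0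

theorem MemH1.isWeakGradient {Ω : Set (Space N)} {u : Space N → ℝ} (h : MemH1 Ω u) :
    IsWeakGradient Ω u (weakGradient Ω u) := by
  unfold weakGradient
  rw [dif_pos h.2]
  exact h.2.choose_spec

theorem MemHLaplacian.isWeakLaplacian {Ω : Set (Space N)} {u : Space N → ℝ}
    (h : MemHLaplacian Ω u) : IsWeakLaplacian Ω u (weakLaplacian Ω u) := by
  unfold weakLaplacian
  rw [dif_pos h.2]
  exact h.2.choose_spec

/-- `u ∈ H¹₀(Ω)`: the function `u ∈ H¹(Ω)` is a limit in `H¹(Ω)` of functions in `C_c^∞(Ω)`. -/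
def MemH10 (Ω : Set (Space N)) (u : Space N → ℝ) : Prop :=
  MemH1 Ω u ∧ ∃ φ : ℕ → Space N → ℝ, (∀ n, IsTestFunction Ω (φ n)) ∧
    Tendsto (fun n => normL2 Ω (fun x => u x - φ n x)) atTop (𝓝 0) ∧
    Tendsto (fun n => normL2 Ω (fun x => weakGradient Ω u x - gradient (φ n) x)) atTop (𝓝 0)

/-- `u` is the weak solution, with datum `f ∈ H¹(Ω)`, of the Navier problem `Δ²u = 0` in `Ω`,
`u = 0` and `Δu = f` on `∂Ω`. -/
def IsNavierSolution (Ω : Set (Space N)) (f u : Space N → ℝ) : Prop :=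
  MemHLaplacian Ω u ∧ MemH10 Ω u ∧
    ∀ φ : Space N → ℝ, MemHLaplacian Ω φ → MemH10 Ω φ →
      ∫ x in Ω, weakLaplacian Ω u x * weakLaplacian Ω φ x =
        ∫ x in Ω, (f x * weakLaplacian Ω φ x +
          inner ℝ (weakGradient Ω f x) (weakGradient Ω φ x))

/-- Compact convergence of the sets `Ωε ε` to `Ω` as `ε → 0+`: every compact subset of `Ω` lies in
`Ωε ε`, and every compact subset of the exterior of `Ω` lies in the exterior of `Ωε ε`, as soon as
`ε` is small enough. -/
def CompactlyConverges (Ωε : ℝ → Set (Space N)) (Ω : Set (Space N)) : Prop :=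
  (∀ K : Set (Space N), IsCompact K → K ⊆ Ω →
    ∃ ε₀ > 0, ∀ ε, 0 < ε → ε < ε₀ → K ⊆ Ωε ε) ∧
  (∀ K : Set (Space N), IsCompact K → K ⊆ (closure Ω)ᶜ →
    ∃ ε₀ > 0, ∀ ε, 0 < ε → ε < ε₀ → K ⊆ (closure (Ωε ε))ᶜ)

/-- `Ω` is stable: every function in `H¹(ℝ^N)` that vanishes almost everywhere outside the closure
of `Ω` belongs to `H¹₀(Ω)`. Here `H¹₀(Ω)` is regarded, through extension by zero, as a space of
functions on `ℝ^N`; so membership says that the function vanishes almost everywhere outside `Ω`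
and that its restriction to `Ω` is in `H¹₀(Ω)`. -/
def IsStable (Ω : Set (Space N)) : Prop :=
  ∀ w : Space N → ℝ, MemH1 Set.univ w → (∀ᵐ x, x ∉ closure Ω → w x = 0) →
    (∀ᵐ x, x ∉ Ω → w x = 0) ∧ MemH10 Ω w

/-- The extension by zero `v₀` of a function `v` defined on `Ω`. -/
def zeroExt {F : Type*} [Zero F] (Ω : Set (Space N)) (v : Space N → F) : Space N → F :=
  Ω.indicator v

end NavierProblem

end

/-! The fourth-order problem splits into two Dirichlet problems. Put `w = Δu`. Testing the weak
formulation with the `Φ ∈ H¹₀(Ω)` whose Laplacian is `w - f - z`, where `z ∈ H¹₀(Ω)` satisfies `∫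
∇z·∇y = -∫ ∇f·∇y` for all `y ∈ H¹₀(Ω)`, gives `‖w - f - z‖² = 0`. So `w = f + z` is the harmonic
function with boundary values `f`, and `u` solves `Δu = w` in `H¹₀(Ω)`
(`IsNavierSolution.exists_split`).

It remains to show that Dirichlet solutions depend continuously on the domain and the data
(`tendsto_of_solvesDirichlet`). Functions of `H¹₀(Ωε)` are extended by zero and identified with
pairs `(v, ∇v)`, so all these spaces are closed subspaces of one Hilbert space, and Poincaré's
inequality on a ball containing `D` gives a constant independent of `ε`. The subspaces converge in
the sense of Mosco: each test function on `Ω` is eventually a test function on `Ωε`, and weak limits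
from `H¹₀(Ωε)` vanish outside the closure of `Ω`, hence lie in `H¹₀(Ω)` by stability
(`CompactlyConverges.weak_limit_mem`). Then the solutions converge weakly, and convergence of their
energies makes this strong (`tendsto_of_solvesIn`).

Applying this to `zε`, then to `uε` with data `fε + zε`, gives the three limits; the Laplacian is
covered because it equals `fε + zε`. -/

noncomputable section

namespace NavierProblem

/-! ### Variational problems on varying subspaces of a Hilbert space -/

section Abstract

variable {ι H G : Type*} [NormedAddCommGroup H] [InnerProductSpace ℝ H]
  [NormedAddCommGroup G] [InnerProductSpace ℝ G]

/-- Along an ultrafilter, a bounded family in a Hilbert space has a weak limit. -/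
theorem exists_weak_limit [CompleteSpace H] (U : Ultrafilter ι) (z : ι → H) (M : ℝ)
    (hM : ∀ᶠ i in (U : Filter ι), ‖z i‖ ≤ M) :
    ∃ z₀ : H, ∀ y, Tendsto (fun i => inner ℝ (z i) y) U (𝓝 (inner ℝ z₀ y)) := by
  have hbd : ∀ y, ∀ᶠ i in (U : Filter ι), inner ℝ (z i) y ∈ Set.Icc (-(M * ‖y‖)) (M * ‖y‖) := by
    intro y
    filter_upwards [hM] with i hi
    have h := abs_real_inner_le_norm (z i) y
    exact abs_le.mp (h.trans (by gcongr))
  have hlim : ∀ y, ∃ a ∈ Set.Icc (-(M * ‖y‖)) (M * ‖y‖),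
      Tendsto (fun i => inner ℝ (z i) y) U (𝓝 a) := by
    intro y
    exact isCompact_Icc.ultrafilter_le_nhds' (U.map fun i => inner ℝ (z i) y) (hbd y)
  choose L hLb hL using hlim
  -- The limits of the pairings are linear in `y` by uniqueness of limits and bounded by `M`; Riesz
  -- representation then yields the weak limit. Ultrafilters take the place of subsequences, so no
  -- separability is needed.
  let L' : H →ₗ[ℝ] ℝ :=
    { toFun := L
      map_add' := fun x y => tendsto_nhds_unique (hL (x + y)) (by
        simpa only [inner_add_right] using (hL x).add (hL y))
      map_smul' := fun c x => tendsto_nhds_unique (hL (c • x)) (by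
        simpa only [inner_smul_right, RingHom.id_apply, smul_eq_mul] using (hL x).const_mul c) }
  let ℓ : StrongDual ℝ H := L'.mkContinuous M (fun x => abs_le.mpr (hLb x))
  refine ⟨(InnerProductSpace.toDual ℝ H).symm ℓ, fun y => ?_⟩
  rw [InnerProductSpace.toDual_symm_apply]
  exact hL y

/-- `z` is the Galerkin solution in `V` of `⟪P z, P y⟫ = ⟪F, y⟫`. -/
def SolvesIn (P : H →L[ℝ] G) (V : Submodule ℝ H) (F z : H) : Prop :=
  z ∈ V ∧ ∀ y ∈ V, inner ℝ (P z) (P y) = inner ℝ F y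

/-- Testing with `z` itself gives `‖P z‖² ≤ ‖F‖ ‖z‖`. The bound involves `V` only through `C`, hence
is uniform over a family of subspaces sharing `C`. -/
theorem SolvesIn.norm_le {P : H →L[ℝ] G} {V : Submodule ℝ H} {F z : H} {C : ℝ}
    (h : SolvesIn P V F z) (hV : ‖z‖ ≤ C * ‖P z‖) : ‖z‖ ≤ C ^ 2 * ‖F‖ := by
  have h1 : ‖P z‖ ^ 2 ≤ ‖F‖ * ‖z‖ := by
    rw [← real_inner_self_eq_norm_sq, h.2 z h.1]
    exact real_inner_le_norm _ _
  have h2 : ‖z‖ ^ 2 ≤ C ^ 2 * ‖P z‖ ^ 2 := by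
    rw [← mul_pow]; exact pow_le_pow_left₀ (norm_nonneg _) hV 2
  by_cases hz : ‖z‖ = 0
  · rw [hz]; positivity
  · have hz' : 0 < ‖z‖ := lt_of_le_of_ne (norm_nonneg _) (Ne.symm hz)
    refine le_of_mul_le_mul_right ?_ hz'
    nlinarith [sq_nonneg C]

/-- Lax–Milgram on `V`: the estimate `‖x‖ ≤ C ‖P x‖` makes the form coercive. -/
theorem exists_solvesIn [CompleteSpace H] (P : H →L[ℝ] G) (V : Submodule ℝ H)
    (hV : IsClosed (V : Set H)) (C : ℝ) (hC : ∀ x ∈ V, ‖x‖ ≤ C * ‖P x‖) (F : H) :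
    ∃ z, SolvesIn P V F z := by
  have : CompleteSpace V := hV.completeSpace_coe
  let Q : V →L[ℝ] G := P.comp V.subtypeL
  let B : V →L[ℝ] V →L[ℝ] ℝ := (innerSL ℝ).bilinearComp Q Q
  have hBapp : ∀ x y : V, B x y = inner ℝ (P x) (P y) := fun x y => rfl
  have hco : IsCoercive B := by
    -- The summand `1` keeps the constant positive even if `C = 0`.
    refine ⟨(C ^ 2 + 1)⁻¹, by positivity, fun x => ?_⟩
    rw [hBapp, real_inner_self_eq_norm_sq, mul_assoc, ← sq, inv_mul_le_iff₀ (by positivity)]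
    have h2 : ‖(x : H)‖ ^ 2 ≤ C ^ 2 * ‖P x‖ ^ 2 := by
      rw [← mul_pow]; exact pow_le_pow_left₀ (norm_nonneg _) (hC x x.2) 2
    change ‖(x : H)‖ ^ 2 ≤ _
    nlinarith [sq_nonneg ‖P x‖]
  let f : V := (InnerProductSpace.toDual ℝ V).symm ((innerSL ℝ F).comp V.subtypeL)
  let z := hco.continuousLinearEquivOfBilin.symm f
  refine ⟨z, z.2, fun y hy => ?_⟩
  have h := hco.continuousLinearEquivOfBilin_apply z ⟨y, hy⟩
  rw [hBapp] at h
  rw [← h, ContinuousLinearEquiv.apply_symm_apply, InnerProductSpace.toDual_symm_apply]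
  rfl

/-- `hD` and `hweak` express Mosco convergence of `Vi` to `V`. The uniform bound gives a weak limit,
`hweak` puts it in `V`, and passing to the limit on the dense set `D` identifies it with `z`. Strong
convergence follows from convergence of the energies. -/
theorem tendsto_of_solvesIn [CompleteSpace H] [CompleteSpace G] {l : Filter ι} (P : H →L[ℝ] G)
    (V W : Submodule ℝ H)
    (Vi : ι → Submodule ℝ H) (C : ℝ) (hC : ∀ x ∈ W, ‖x‖ ≤ C * ‖P x‖) (hVW : V ≤ W)
    (hViW : ∀ᶠ i in l, Vi i ≤ W) (D : Set H) (hVD : (V : Set H) ⊆ closure D)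
    (hD : ∀ y ∈ D, ∀ᶠ i in l, y ∈ Vi i)
    (hweak : ∀ U : Ultrafilter ι, (U : Filter ι) ≤ l → ∀ x : ι → H, (∀ᶠ i in l, x i ∈ Vi i) →
      ∀ x₀, (∀ y, Tendsto (fun i => inner ℝ (x i) y) U (𝓝 (inner ℝ x₀ y))) → x₀ ∈ V)
    {F : H} {Fi : ι → H} (hF : Tendsto Fi l (𝓝 F)) {z : H} {zi : ι → H}
    (hz : SolvesIn P V F z) (hzi : ∀ᶠ i in l, SolvesIn P (Vi i) (Fi i) (zi i)) :
    Tendsto zi l (𝓝 z) := by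
  rw [tendsto_iff_ultrafilter]
  intro U hU
  have hFU : Tendsto Fi U (𝓝 F) := hF.mono_left hU
  have hFb : ∀ᶠ i in (U : Filter ι), ‖Fi i‖ ≤ ‖F‖ + 1 :=
    (hFU.norm.eventually (eventually_lt_nhds (lt_add_one ‖F‖))).mono fun i hi => hi.le
  have hzb : ∀ᶠ i in (U : Filter ι), ‖zi i‖ ≤ C ^ 2 * (‖F‖ + 1) := by
    filter_upwards [hFb, hU hzi, hU hViW] with i h1 h2 h3
    exact (h2.norm_le (hC _ (h3 h2.1))).trans (by gcongr)
  obtain ⟨z₀, hz₀⟩ := exists_weak_limit U zi _ hzb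
  have hz₀V : z₀ ∈ V := hweak U hU zi (hzi.mono fun i h => h.1) z₀ hz₀
  have hPlim : ∀ y, Tendsto (fun i => inner ℝ (P (zi i)) (P y)) U
      (𝓝 (inner ℝ (P z₀) (P y))) := by
    intro y
    simpa only [ContinuousLinearMap.adjoint_inner_right] using
      hz₀ (ContinuousLinearMap.adjoint P (P y))
  have hdata : ∀ {a : ι → H} {a₀ : H}, Tendsto a U (𝓝 a₀) →
      Tendsto (fun i => inner ℝ (a i) (zi i)) U (𝓝 (inner ℝ a₀ z₀)) := by
    intro a a₀ ha
    have h1 : Tendsto (fun i => inner ℝ (a i - a₀) (zi i)) U (𝓝 0) := by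
      have h2 : Tendsto (fun i => ‖a i - a₀‖ * (C ^ 2 * (‖F‖ + 1))) U (𝓝 0) := by
        have := (tendsto_iff_norm_sub_tendsto_zero.mp ha).mul_const (C ^ 2 * (‖F‖ + 1))
        simpa using this
      refine squeeze_zero_norm' ?_ h2
      filter_upwards [hzb] with i hi
      exact (norm_inner_le_norm _ _).trans (by gcongr)
    have h3 := h1.add (hz₀ a₀)
    rw [zero_add, real_inner_comm] at h3
    refine h3.congr fun i => ?_
    rw [inner_sub_left, real_inner_comm a₀ (zi i)]
    ring
  have heqD : ∀ y ∈ D, inner ℝ (P z₀) (P y) = inner ℝ F y := by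
    intro y hy
    refine tendsto_nhds_unique (hPlim y) ?_
    have h1 : Tendsto (fun i => inner ℝ (Fi i) y) U (𝓝 (inner ℝ F y)) :=
      hFU.inner tendsto_const_nhds
    refine h1.congr' ?_
    filter_upwards [hU hzi, hU (hD y hy)] with i h2 h3
    exact (h2.2 y h3).symm
  have heq : ∀ y ∈ V, inner ℝ (P z₀) (P y) = inner ℝ F y := by
    have hcl : IsClosed {y : H | inner ℝ (P z₀) (P y) = inner ℝ F y} :=
      isClosed_eq (by fun_prop) (by fun_prop)
    exact fun y hy => closure_minimal heqD hcl (hVD hy)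
  have hz₀z : z₀ = z := by
    have hd : z₀ - z ∈ V := V.sub_mem hz₀V hz.1
    have h1 : inner ℝ (P (z₀ - z)) (P (z₀ - z)) = 0 := by
      rw [map_sub, inner_sub_left, ← map_sub, heq _ hd, hz.2 _ hd, sub_self]
    have h2 := hC _ (hVW hd)
    rw [inner_self_eq_zero.mp h1, norm_zero, mul_zero] at h2
    exact sub_eq_zero.mp (norm_le_zero_iff.mp h2)
  subst hz₀z
  rw [tendsto_iff_norm_sub_tendsto_zero]
  -- By the equation for `zi`, `‖P (zi - z₀)‖² = ⟪Fi, zi⟫ - 2⟪P zi, P z₀⟫ + ‖P z₀‖²`, which tends to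
  -- `0` because `⟪F, z₀⟫ = ‖P z₀‖²`.
  have hsq : Tendsto (fun i => ‖zi i - z₀‖ ^ 2) U (𝓝 0) := by
    have h1 := ((hdata hFU).sub ((hPlim z₀).const_mul 2)).add
      (tendsto_const_nhds (x := inner ℝ (P z₀) (P z₀)))
    have h2 := h1.const_mul (C ^ 2)
    rw [← heq z₀ hz₀V] at h2
    have h0 : C ^ 2 * (inner ℝ (P z₀) (P z₀) - 2 * inner ℝ (P z₀) (P z₀) +
      inner ℝ (P z₀) (P z₀)) = 0 := by ring
    rw [h0] at h2
    refine squeeze_zero' (Eventually.of_forall fun i => by positivity) ?_ h2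
    filter_upwards [hU hzi, hU hViW] with i h3 h4
    have h5 := pow_le_pow_left₀ (norm_nonneg _) (hC _ (W.sub_mem (h4 h3.1) (hVW hz₀V))) 2
    rw [mul_pow, map_sub, ← real_inner_self_eq_norm_sq (P (zi i) - P z₀),
      real_inner_sub_sub_self, h3.2 _ h3.1] at h5
    exact h5
  have := hsq.sqrt
  simpa using this

end Abstract

/-! ### Calculus of test functions and the Poincaré inequality -/

variable {N : ℕ}

theorem gradient_apply (φ : Space N → ℝ) (x : Space N) (i : Fin N) :
    gradient φ x i = fderiv ℝ φ x (EuclideanSpace.single i 1) := by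
  have h := EuclideanSpace.inner_single_right (𝕜 := ℝ) i 1 (gradient φ x)
  rw [gradient, InnerProductSpace.toDual_symm_apply] at h
  simpa [gradient] using h.symm

theorem gradient_eq_comp (φ : Space N → ℝ) :
    gradient φ = (InnerProductSpace.toDual ℝ (Space N)).symm ∘ fderiv ℝ φ := rfl

namespace IsTestFunction

variable {Ω Ω' : Set (Space N)} {φ ψ : Space N → ℝ}

theorem mono (h : IsTestFunction Ω φ) (hΩ : Ω ⊆ Ω') : IsTestFunction Ω' φ :=
  ⟨h.1, h.2.1, h.2.2.trans hΩ⟩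

theorem of_tsupport (h : IsTestFunction Ω' φ) (hΩ : tsupport φ ⊆ Ω) : IsTestFunction Ω φ :=
  ⟨h.1, h.2.1, hΩ⟩

theorem zero : IsTestFunction Ω (0 : Space N → ℝ) :=
  ⟨contDiff_const, HasCompactSupport.zero, by simp⟩

theorem add (h : IsTestFunction Ω φ) (h' : IsTestFunction Ω ψ) : IsTestFunction Ω (φ + ψ) :=
  ⟨h.1.add h'.1, h.2.1.add h'.2.1,
    (tsupport_add φ ψ).trans (Set.union_subset h.2.2 h'.2.2)⟩

theorem const_smul (h : IsTestFunction Ω φ) (c : ℝ) : IsTestFunction Ω (c • φ) :=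
  ⟨h.1.const_smul c, h.2.1.smul_left (f := fun _ => c),
    (tsupport_smul_subset_right (fun _ => c) φ).trans h.2.2⟩

theorem differentiable (h : IsTestFunction Ω φ) : Differentiable ℝ φ :=
  h.1.differentiable (by simp)

theorem eq_zero_of_notMem (h : IsTestFunction Ω φ) {x : Space N} (hx : x ∉ Ω) : φ x = 0 :=
  image_eq_zero_of_notMem_tsupport fun hx' => hx (h.2.2 hx')

theorem partialDeriv (h : IsTestFunction Ω φ) (i : Fin N) :
    IsTestFunction Ω (fun x => gradient φ x i) := by
  simp only [gradient_apply]
  refine ⟨?_, ?_, ?_⟩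
  · exact (h.1.fderiv_right (by simp)).clm_apply contDiff_const
  · exact h.2.1.fderiv_apply (𝕜 := ℝ) _
  · exact (tsupport_fderiv_apply_subset ℝ _).trans h.2.2

theorem continuous_gradient (h : IsTestFunction Ω φ) : Continuous (gradient φ) := by
  rw [gradient_eq_comp]
  exact (LinearIsometryEquiv.continuous _).comp (h.1.continuous_fderiv (by simp))

theorem hasCompactSupport_gradient (h : IsTestFunction Ω φ) :
    HasCompactSupport (gradient φ) := by
  rw [gradient_eq_comp]
  exact (h.2.1.fderiv (𝕜 := ℝ)).comp_left (by simp)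

theorem gradient_eq_zero_of_notMem (h : IsTestFunction Ω φ) {x : Space N} (hx : x ∉ Ω) :
    gradient φ x = 0 := by
  ext i
  exact (h.partialDeriv i).eq_zero_of_notMem hx

theorem memLp (h : IsTestFunction Ω φ) : MemLp φ 2 (volume : Measure (Space N)) :=
  h.1.continuous.memLp_of_hasCompactSupport h.2.1

theorem memLp_gradient (h : IsTestFunction Ω φ) :
    MemLp (gradient φ) 2 (volume : Measure (Space N)) :=
  h.continuous_gradient.memLp_of_hasCompactSupport h.hasCompactSupport_gradient

theorem gradient_add (h : IsTestFunction Ω φ) (h' : IsTestFunction Ω ψ) :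
    gradient (φ + ψ) = gradient φ + gradient ψ := by
  ext x i
  simp only [gradient_apply, Pi.add_apply, PiLp.add_apply]
  rw [fderiv_add h.differentiable.differentiableAt h'.differentiable.differentiableAt]
  rfl

theorem gradient_const_smul (h : IsTestFunction Ω φ) (c : ℝ) :
    gradient (c • φ) = c • gradient φ := by
  ext x i
  simp only [gradient_apply, Pi.smul_apply, PiLp.smul_apply]
  rw [fderiv_const_smul h.differentiable.differentiableAt]
  rfl

theorem integrable_mul (h : IsTestFunction Ω φ) {g : Space N → ℝ} (hg : Continuous g) :
    Integrable (fun x => φ x * g x) :=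
  (h.1.continuous.mul hg).integrable_of_hasCompactSupport h.2.1.mul_right

theorem integral_mul_gradient (h : IsTestFunction Ω φ) (h' : IsTestFunction Ω' ψ) (i : Fin N) :
    ∫ x, φ x * gradient ψ x i = -∫ x, gradient φ x i * ψ x := by
  have h1 := (h.partialDeriv i).integrable_mul h'.1.continuous
  have h2 := h.integrable_mul (h'.partialDeriv i).1.continuous
  have h3 := h.integrable_mul h'.1.continuous
  simp only [gradient_apply] at h1 h2 ⊢
  exact integral_mul_fderiv_eq_neg_fderiv_mul_of_integrable h1 h2 h3
    (fun x _ => h.differentiable.differentiableAt) (fun x _ => h'.differentiable.differentiableAt)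

theorem laplacian_eq (h : IsTestFunction Ω φ) (x : Space N) :
    Laplacian.laplacian φ x = ∑ i, gradient (fun y => gradient φ y i) x i := by
  rw [InnerProductSpace.laplacian_eq_iteratedFDeriv_orthonormalBasis φ
    (EuclideanSpace.basisFun (Fin N) ℝ)]
  refine Finset.sum_congr rfl fun i _ => ?_
  simp only [gradient_apply]
  rw [iteratedFDeriv_two_apply]
  have h1 : DifferentiableAt ℝ (fderiv ℝ φ) x :=
    ((h.1.fderiv_right (m := 1) (by norm_cast)).differentiable (by simp)).differentiableAt
  rw [fderiv_clm_apply h1 (differentiableAt_const _)]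
  simp

/-- The Poincaré inequality for test functions, in `L²(ℝ^N)`. -/
theorem norm_toLp_le {R : ℝ} (h : IsTestFunction (Metric.closedBall 0 R) φ) (i : Fin N) :
    ‖h.memLp.toLp φ‖ ≤ 2 * R * ‖h.memLp_gradient.toLp (gradient φ)‖ := by
  have hx : Differentiable ℝ (fun x : Space N => x i) := by fun_prop
  have hxc : Continuous (fun x : Space N => x i) := hx.continuous
  let η : Space N → ℝ := fun x => x i * gradient φ x i
  have hηL : MemLp η 2 (volume : Measure (Space N)) :=
    (hxc.mul (h.partialDeriv i).1.continuous).memLp_of_hasCompactSupport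
      ((h.partialDeriv i).2.1.mul_left)
  have h1 : ‖hηL.toLp η‖ ≤ R * ‖h.memLp_gradient.toLp (gradient φ)‖ := by
    refine Lp.norm_le_mul_norm_of_ae_le_mul ?_
    filter_upwards [hηL.coeFn_toLp, h.memLp_gradient.coeFn_toLp] with x e1 e2
    rw [e1, e2]
    by_cases hxR : x ∈ Metric.closedBall 0 R
    · rw [mem_closedBall_zero_iff] at hxR
      rw [norm_mul]
      have hxi := (PiLp.norm_apply_le x i).trans hxR
      exact mul_le_mul hxi (PiLp.norm_apply_le _ i) (norm_nonneg _) ((norm_nonneg _).trans hxi)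
    · simp [η, h.gradient_eq_zero_of_notMem hxR]
  have hsq : IsTestFunction (Metric.closedBall 0 R) (fun x => φ x * φ x) :=
    ⟨h.1.mul h.1, h.2.1.mul_right, (tsupport_mul_subset_left).trans h.2.2⟩
  have hfd : ∀ x, fderiv ℝ (fun x => φ x * φ x) x (EuclideanSpace.single i 1) =
      2 * (φ x * gradient φ x i) := by
    intro x
    rw [fderiv_fun_mul h.differentiable.differentiableAt h.differentiable.differentiableAt,
      gradient_apply]
    simp
    ring
  have hxd : ∀ x, fderiv ℝ (fun x : Space N => x i) x (EuclideanSpace.single i 1) = 1 := by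
    intro x
    have : (fun x : Space N => x i) = EuclideanSpace.proj (𝕜 := ℝ) i := rfl
    rw [this, ContinuousLinearMap.fderiv]
    simp
  -- Since `∂ᵢxᵢ = 1`, integration by parts gives `∫ φ² = -2 ∫ xᵢ φ ∂ᵢφ`, and `|xᵢ| ≤ R` on the
  -- support; Cauchy–Schwarz and division by `‖φ‖` conclude.
  have hibp := integral_mul_fderiv_eq_neg_fderiv_mul_of_integrable
    (μ := (volume : Measure (Space N)))
    (f := fun x => φ x * φ x) (g := fun x => x i) (v := EuclideanSpace.single i 1)
    (by
      have := (h.integrable_mul (hxc.mul (h.partialDeriv i).1.continuous)).const_mul 2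
      refine this.congr (Eventually.of_forall fun x => ?_)
      simp only [hfd, Pi.mul_apply]; ring)
    (by simpa only [hxd] using hsq.integrable_mul continuous_const)
    (hsq.integrable_mul hxc)
    (fun x _ => hsq.differentiable.differentiableAt) (fun x _ => hx.differentiableAt)
  simp only [hxd, hfd, mul_one] at hibp
  have h2 : ‖h.memLp.toLp φ‖ ^ 2 = ∫ x, φ x * φ x := by
    rw [← real_inner_self_eq_norm_sq, L2.inner_def]
    refine integral_congr_ae ?_
    filter_upwards [h.memLp.coeFn_toLp] with x e1
    rw [e1]; rfl
  have h3 : inner ℝ (h.memLp.toLp φ) (hηL.toLp η) = ∫ x, η x * φ x := by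
    rw [L2.inner_def]
    refine integral_congr_ae ?_
    filter_upwards [h.memLp.coeFn_toLp, hηL.coeFn_toLp] with x e1 e2
    rw [e1, e2]; rfl
  have h4 : ‖h.memLp.toLp φ‖ ^ 2 = -2 * inner ℝ (h.memLp.toLp φ) (hηL.toLp η) := by
    rw [h2, hibp, h3, neg_mul, ← integral_const_mul]
    congr 2
    ext x
    simp only [η]; ring
  have h5 : |inner ℝ (h.memLp.toLp φ) (hηL.toLp η)| ≤ _ := abs_real_inner_le_norm _ _
  by_cases h0 : ‖h.memLp.toLp φ‖ = 0
  · rw [h0]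
    have := (norm_nonneg _).trans h1
    linarith
  · have h0' : 0 < ‖h.memLp.toLp φ‖ := lt_of_le_of_ne (norm_nonneg _) (Ne.symm h0)
    refine le_of_mul_le_mul_left ?_ h0'
    have := neg_le_of_abs_le h5
    have := mul_le_mul_of_nonneg_left h1 h0'.le
    nlinarith

end IsTestFunction

/-! ### The spaces `H¹₀(Ω)` inside one fixed Hilbert space -/

/-- Pairs of a scalar and a vector field in `L²(ℝ^N)`. -/
abbrev SobolevPair (N : ℕ) : Type :=
  WithLp 2 (Lp ℝ 2 (volume : Measure (Space N)) × Lp (Space N) 2 (volume : Measure (Space N)))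

theorem SobolevPair.continuous_fst : Continuous fun x : SobolevPair N => x.fst :=
  WithLp.continuous_fst _ _ _

theorem SobolevPair.continuous_snd : Continuous fun x : SobolevPair N => x.snd :=
  WithLp.continuous_snd _ _ _

/-- The pair `(φ, ∇φ)` of a test function. -/
def IsTestFunction.pair {Ω : Set (Space N)} {φ : Space N → ℝ} (h : IsTestFunction Ω φ) :
    SobolevPair N :=
  WithLp.toLp 2 (h.memLp.toLp φ, h.memLp_gradient.toLp (gradient φ))

/-- The pairs `(φ, ∇φ)` with `φ ∈ C_c^∞(Ω)`. -/
def testPairs (Ω : Set (Space N)) : Submodule ℝ (SobolevPair N) where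
  carrier := {x | ∃ (φ : Space N → ℝ) (h : IsTestFunction Ω φ), x = h.pair}
  zero_mem' := by
    refine ⟨0, IsTestFunction.zero, ?_⟩
    have hg : gradient (0 : Space N → ℝ) = 0 := by
      ext x i
      exact (IsTestFunction.zero (Ω := ∅)).partialDeriv i |>.eq_zero_of_notMem (by simp)
    apply WithLp.ofLp_injective
    simp only [IsTestFunction.pair, hg]
    rfl
  add_mem' := by
    rintro _ _ ⟨φ, h, rfl⟩ ⟨ψ, h', rfl⟩
    refine ⟨_, h.add h', ?_⟩
    apply WithLp.ofLp_injective
    simp only [IsTestFunction.pair, h.gradient_add h']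
    rfl
  smul_mem' := by
    rintro c _ ⟨φ, h, rfl⟩
    refine ⟨_, h.const_smul c, ?_⟩
    apply WithLp.ofLp_injective
    simp only [IsTestFunction.pair, h.gradient_const_smul c]
    rfl

/-- The space `H¹₀(Ω)`, extended by zero and embedded by `u ↦ (u, ∇u)`. -/
def sobolevZero (Ω : Set (Space N)) : Submodule ℝ (SobolevPair N) :=
  (testPairs Ω).topologicalClosure

variable {Ω Ω' : Set (Space N)}

theorem testPairs_mono (h : Ω ⊆ Ω') : testPairs Ω ≤ testPairs Ω' := by
  rintro _ ⟨φ, hφ, rfl⟩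
  exact ⟨φ, hφ.mono h, rfl⟩

theorem sobolevZero_mono (h : Ω ⊆ Ω') : sobolevZero Ω ≤ sobolevZero Ω' :=
  Submodule.topologicalClosure_mono (testPairs_mono h)

theorem isClosed_sobolevZero (Ω : Set (Space N)) :
    IsClosed (sobolevZero Ω : Set (SobolevPair N)) :=
  Submodule.isClosed_topologicalClosure _

theorem testPairs_le_sobolevZero (Ω : Set (Space N)) : testPairs Ω ≤ sobolevZero Ω :=
  Submodule.le_topologicalClosure _

theorem IsTestFunction.pair_mem {φ : Space N → ℝ} (h : IsTestFunction Ω φ) :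
    h.pair ∈ sobolevZero Ω :=
  testPairs_le_sobolevZero Ω ⟨φ, h, rfl⟩

/-- A closed condition that holds for test functions holds on `H¹₀(Ω)`. -/
theorem sobolevZero_induction {p : SobolevPair N → Prop} (hp : IsClosed {x | p x})
    (h : ∀ (φ : Space N → ℝ) (hφ : IsTestFunction Ω φ), p hφ.pair) {x : SobolevPair N}
    (hx : x ∈ sobolevZero Ω) : p x := by
  refine closure_minimal (s := (testPairs Ω : Set (SobolevPair N))) ?_ hp hx
  rintro _ ⟨φ, hφ, rfl⟩
  exact h φ hφ

/-- The set is the kernel of the continuous restriction map to the complement of `Ω`. -/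
theorem isClosed_ae_eq_zero_off {F : Type*} [NormedAddCommGroup F] [NormedSpace ℝ F]
    (hΩ : MeasurableSet Ω) :
    IsClosed {f : Lp F 2 (volume : Measure (Space N)) | ∀ᵐ x, x ∉ Ω → f x = 0} := by
  have h : {f : Lp F 2 (volume : Measure (Space N)) | ∀ᵐ x, x ∉ Ω → f x = 0} =
      LpToLpRestrictCLM (Space N) F ℝ volume 2 Ωᶜ ⁻¹' {0} := by
    ext f
    rw [Set.mem_preimage, Set.mem_singleton_iff, Lp.eq_zero_iff_ae_eq_zero]
    change (∀ᵐ x, x ∈ Ωᶜ → f x = 0) ↔ _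
    rw [← ae_restrict_iff' hΩ.compl (p := fun x => f x = 0)]
    have h1 := LpToLpRestrictCLM_coeFn (𝕜 := ℝ) Ωᶜ f
    constructor <;> intro h2 <;> filter_upwards [h1, h2] with x e1 e2
    · rw [e1, e2]; rfl
    · rw [← e1, e2]; rfl
  rw [h]
  exact isClosed_singleton.preimage (ContinuousLinearMap.continuous _)

theorem fst_eq_zero_off (hΩ : MeasurableSet Ω) {x : SobolevPair N} (hx : x ∈ sobolevZero Ω) :
    ∀ᵐ a, a ∉ Ω → x.fst a = 0 := by
  refine sobolevZero_induction (p := fun x => ∀ᵐ a, a ∉ Ω → x.fst a = 0)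
    ((isClosed_ae_eq_zero_off hΩ).preimage SobolevPair.continuous_fst) (fun φ hφ => ?_) hx
  filter_upwards [hφ.memLp.coeFn_toLp] with a e ha
  exact e.trans (hφ.eq_zero_of_notMem ha)

theorem snd_eq_zero_off (hΩ : MeasurableSet Ω) {x : SobolevPair N} (hx : x ∈ sobolevZero Ω) :
    ∀ᵐ a, a ∉ Ω → x.snd a = 0 := by
  refine sobolevZero_induction (p := fun x => ∀ᵐ a, a ∉ Ω → x.snd a = 0)
    ((isClosed_ae_eq_zero_off hΩ).preimage SobolevPair.continuous_snd) (fun φ hφ => ?_) hx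
  filter_upwards [hφ.memLp_gradient.coeFn_toLp] with a e ha
  exact e.trans (hφ.gradient_eq_zero_of_notMem ha)

theorem inner_toLp {F : Type*} [NormedAddCommGroup F] [InnerProductSpace ℝ F]
    (a : Lp F 2 (volume : Measure (Space N))) {g : Space N → F} (hg : MemLp g 2 volume) :
    inner ℝ a (hg.toLp g) = ∫ x, inner ℝ (a x) (g x) := by
  rw [L2.inner_def]
  refine integral_congr_ae ?_
  filter_upwards [hg.coeFn_toLp] with x e
  rw [e]

theorem inner_toLp_real (a : Lp ℝ 2 (volume : Measure (Space N))) {g : Space N → ℝ}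
    (hg : MemLp g 2 volume) : inner ℝ a (hg.toLp g) = ∫ x, a x * g x := by
  rw [inner_toLp]
  refine integral_congr_ae (Eventually.of_forall fun x => ?_)
  simp [mul_comm]

theorem IsTestFunction.memLp_smul_single {ψ : Space N → ℝ} (h : IsTestFunction Ω ψ) (i : Fin N) :
    MemLp (fun x => ψ x • (EuclideanSpace.single i 1 : Space N)) 2
      (volume : Measure (Space N)) :=
  (h.1.continuous.smul continuous_const).memLp_of_hasCompactSupport h.2.1.smul_right

theorem IsTestFunction.setIntegral_mul_eq {ψ : Space N → ℝ} (h : IsTestFunction Ω ψ)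
    (u : Space N → ℝ) : ∫ x in Ω, u x * ψ x = ∫ x, u x * ψ x :=
  setIntegral_eq_integral_of_forall_compl_eq_zero fun x hx => by
    rw [h.eq_zero_of_notMem hx, mul_zero]

/-- The support of `ψ` is unrelated to `Ω`: extension by zero of an `H¹₀(Ω)` function creates no
jump across `∂Ω`, so its gradient is the zero extension of the gradient. -/
theorem integral_fst_mul_gradient {x : SobolevPair N} (hx : x ∈ sobolevZero Ω) {ψ : Space N → ℝ}
    (hψ : IsTestFunction Ω' ψ) (i : Fin N) :
    ∫ a, x.fst a * gradient ψ a i = -∫ a, x.snd a i * ψ a := by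
  have key : inner ℝ x.fst ((hψ.partialDeriv i).memLp.toLp _) +
      inner ℝ x.snd ((hψ.memLp_smul_single i).toLp _) = 0 := by
    refine sobolevZero_induction (p := fun x => inner ℝ x.fst ((hψ.partialDeriv i).memLp.toLp _) +
      inner ℝ x.snd ((hψ.memLp_smul_single i).toLp _) = 0) ?_ (fun φ hφ => ?_) hx
    · refine isClosed_eq ?_ continuous_const
      exact (SobolevPair.continuous_fst.inner continuous_const).add
        (SobolevPair.continuous_snd.inner continuous_const)
    · rw [inner_toLp_real, inner_toLp]
      have h1 : ∫ a, hφ.pair.fst a * gradient ψ a i = ∫ a, φ a * gradient ψ a i := by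
        refine integral_congr_ae ?_
        filter_upwards [hφ.memLp.coeFn_toLp] with a e
        exact congrArg (· * gradient ψ a i) e
      have h2 : ∫ a, inner ℝ (hφ.pair.snd a) (ψ a • (EuclideanSpace.single i 1 : Space N)) =
          ∫ a, gradient φ a i * ψ a := by
        refine integral_congr_ae ?_
        filter_upwards [hφ.memLp_gradient.coeFn_toLp] with a e
        have e' : hφ.pair.snd a = gradient φ a := e
        rw [e', inner_smul_right, EuclideanSpace.inner_single_right]
        simp [mul_comm]
      rw [h1, h2, hφ.integral_mul_gradient hψ i, neg_add_cancel]
  rw [inner_toLp_real, inner_toLp] at key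
  rw [eq_neg_of_add_eq_zero_left key]
  congr 2
  ext a
  rw [inner_smul_right, EuclideanSpace.inner_single_right]
  simp [mul_comm]

theorem isWeakGradient_of_mem {x : SobolevPair N} (hx : x ∈ sobolevZero Ω)
    (Ω' : Set (Space N)) : IsWeakGradient Ω' x.fst x.snd := by
  refine ⟨(Lp.memLp x.snd).restrict _, fun ψ hψ i => ?_⟩
  rw [(hψ.partialDeriv i).setIntegral_mul_eq, integral_fst_mul_gradient hx hψ i,
    hψ.setIntegral_mul_eq (fun a => x.snd a i)]

/-! ### Uniqueness of weak gradients and Laplacians -/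

theorem MemL2.locallyIntegrableOn {F : Type*} [NormedAddCommGroup F] (hΩ : IsOpen Ω)
    {v : Space N → F} (h : MemL2 Ω v) : LocallyIntegrableOn v Ω := by
  rw [locallyIntegrableOn_iff hΩ.isLocallyClosed]
  intro K hK hKc
  have h1 : MemLp v 2 (volume.restrict K) := h.mono_measure (Measure.restrict_mono hK le_rfl)
  have : IsFiniteMeasure (volume.restrict K) := ⟨by simpa using hKc.measure_lt_top⟩
  exact h1.integrable one_le_two

theorem MemL2.integrable_mul_test {v : Space N → ℝ} (hv : MemL2 Ω v) {φ : Space N → ℝ}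
    (hφ : IsTestFunction Ω φ) : IntegrableOn (fun x => v x * φ x) Ω :=
  hv.integrable_mul (hφ.memLp.restrict Ω)

theorem MemL2.apply {g : Space N → Space N} (hg : MemL2 Ω g) (i : Fin N) :
    MemL2 Ω (fun x => g x i) :=
  (EuclideanSpace.proj (𝕜 := ℝ) i).comp_memLp' hg

/-- Functions in `L²(Ω)` with the same integrals against test functions agree a.e. in `Ω`. -/
theorem MemL2.ae_eq_of_integral_test (hΩ : IsOpen Ω) {v w : Space N → ℝ} (hv : MemL2 Ω v)
    (hw : MemL2 Ω w)
    (h : ∀ φ, IsTestFunction Ω φ → ∫ x in Ω, v x * φ x = ∫ x in Ω, w x * φ x) :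
    v =ᵐ[volume.restrict Ω] w := by
  have h1 := hΩ.ae_eq_zero_of_integral_contDiff_smul_eq_zero
    (f := fun x => v x - w x) (MemL2.locallyIntegrableOn hΩ (hv.sub hw)) (fun φ h1 h2 h3 => by
      have hφ : IsTestFunction Ω φ := ⟨h1, h2, h3⟩
      have e : ∀ x, φ x • (v x - w x) = (v x - w x) * φ x := fun x => by
        rw [smul_eq_mul, mul_comm]
      simp only [e]
      rw [← hφ.setIntegral_mul_eq (fun x => v x - w x)]
      simp only [sub_mul]
      rw [integral_sub (hv.integrable_mul_test hφ) (hw.integrable_mul_test hφ), h φ hφ, sub_self])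
  rw [Filter.EventuallyEq, ae_restrict_iff' hΩ.measurableSet]
  filter_upwards [h1] with x hx hxΩ
  exact sub_eq_zero.mp (hx hxΩ)

theorem IsWeakGradient.ae_eq (hΩ : IsOpen Ω) {u : Space N → ℝ} {g g' : Space N → Space N}
    (h : IsWeakGradient Ω u g) (h' : IsWeakGradient Ω u g') : g =ᵐ[volume.restrict Ω] g' := by
  have h1 : ∀ i, (fun x => g x i) =ᵐ[volume.restrict Ω] fun x => g' x i := fun i =>
    (h.1.apply i).ae_eq_of_integral_test hΩ (h'.1.apply i) fun φ hφ => by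
      have := (h.2 φ hφ i).symm.trans (h'.2 φ hφ i)
      exact neg_injective this
  filter_upwards [ae_all_iff.mpr h1] with x hx
  ext i
  exact hx i

theorem IsWeakLaplacian.ae_eq (hΩ : IsOpen Ω) {u v v' : Space N → ℝ}
    (h : IsWeakLaplacian Ω u v) (h' : IsWeakLaplacian Ω u v') : v =ᵐ[volume.restrict Ω] v' :=
  h.1.ae_eq_of_integral_test hΩ h'.1 fun φ hφ => (h.2 φ hφ).symm.trans (h'.2 φ hφ)

theorem IsWeakLaplacian.congr {u u' v v' : Space N → ℝ}
    (h : IsWeakLaplacian Ω u v) (hu : u =ᵐ[volume.restrict Ω] u')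
    (hv : v =ᵐ[volume.restrict Ω] v') : IsWeakLaplacian Ω u' v' := by
  refine ⟨h.1.ae_eq hv, fun φ hφ => ?_⟩
  have h1 : ∫ x in Ω, v x * φ x = ∫ x in Ω, v' x * φ x := by
    refine integral_congr_ae ?_
    filter_upwards [hv] with x hx
    rw [hx]
  rw [← h1, ← h.2 φ hφ]
  refine integral_congr_ae ?_
  filter_upwards [hu] with x hx
  rw [hx]

/-! ### Extension by zero and `L²` norms -/

section ZeroExt

variable {F : Type*} [NormedAddCommGroup F]

theorem MemL2.memLp_zeroExt (hΩ : MeasurableSet Ω) {v : Space N → F} (hv : MemL2 Ω v) :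
    MemLp (zeroExt Ω v) 2 volume :=
  (memLp_indicator_iff_restrict hΩ).2 hv

/-- The class in `L²(ℝ^N)` of the extension by zero of `v ∈ L²(Ω)`. -/
def MemL2.extLp (hΩ : MeasurableSet Ω) {v : Space N → F} (hv : MemL2 Ω v) :
    Lp F 2 (volume : Measure (Space N)) :=
  (hv.memLp_zeroExt hΩ).toLp _

theorem MemL2.extLp_ae_eq (hΩ : MeasurableSet Ω) {v : Space N → F} (hv : MemL2 Ω v) :
    hv.extLp hΩ =ᵐ[volume] zeroExt Ω v :=
  MemLp.coeFn_toLp _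

theorem zeroExt_ae_eq_restrict (hΩ : MeasurableSet Ω) (v : Space N → F) :
    zeroExt Ω v =ᵐ[volume.restrict Ω] v :=
  indicator_ae_eq_restrict hΩ

theorem MemL2.extLp_ae_eq_restrict (hΩ : MeasurableSet Ω) {v : Space N → F} (hv : MemL2 Ω v) :
    hv.extLp hΩ =ᵐ[volume.restrict Ω] v :=
  Filter.EventuallyEq.trans (ae_restrict_of_ae (hv.extLp_ae_eq hΩ))
    (zeroExt_ae_eq_restrict hΩ v)

theorem ae_eq_zeroExt (hΩ : MeasurableSet Ω) {v w : Space N → F}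
    (h : w =ᵐ[volume.restrict Ω] v) (h0 : ∀ᵐ x, x ∉ Ω → w x = 0) : w =ᵐ[volume] zeroExt Ω v := by
  have h' := (ae_restrict_iff' hΩ).mp h
  filter_upwards [h', h0] with x h1 h2
  by_cases hx : x ∈ Ω
  · rw [h1 hx, zeroExt, Set.indicator_of_mem hx]
  · rw [h2 hx, zeroExt, Set.indicator_of_notMem hx]

theorem eLpNorm_eq_normL2 (hΩ : MeasurableSet Ω) {v w : Space N → F}
    (h : w =ᵐ[volume.restrict Ω] v) (h0 : ∀ᵐ x, x ∉ Ω → w x = 0) :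
    eLpNorm w 2 volume = normL2 Ω v := by
  rw [eLpNorm_congr_ae (ae_eq_zeroExt hΩ h h0), normL2, zeroExt,
    eLpNorm_indicator_eq_eLpNorm_restrict hΩ]

theorem tendsto_normL2_of_tendsto_Lp {ι : Type*} {l : Filter ι} (hΩ : MeasurableSet Ω)
    {a : ι → Lp F 2 (volume : Measure (Space N))} {b : Lp F 2 (volume : Measure (Space N))}
    (hab : Tendsto a l (𝓝 b)) {Ωi : ι → Set (Space N)} {v : ι → Space N → F} {w : Space N → F}
    (hv : ∀ᶠ i in l, a i =ᵐ[volume.restrict (Ωi i)] v i)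
    (hw : b =ᵐ[volume.restrict Ω] w) (hb0 : ∀ᵐ x, x ∉ Ω → b x = 0) :
    Tendsto (fun i => normL2 (Ωi i) (fun x => v i x - zeroExt Ω w x)) l (𝓝 0) := by
  rw [Lp.tendsto_Lp_iff_tendsto_eLpNorm'] at hab
  refine tendsto_of_tendsto_of_tendsto_of_le_of_le' tendsto_const_nhds hab
    (Eventually.of_forall fun _ => zero_le) ?_
  filter_upwards [hv] with i hi
  have h1 : (fun x => v i x - zeroExt Ω w x) =ᵐ[volume.restrict (Ωi i)] ⇑(a i) - ⇑b := by
    filter_upwards [hi, ae_restrict_of_ae (ae_eq_zeroExt hΩ hw hb0)] with x e1 e2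
    rw [Pi.sub_apply, e1, e2]
  rw [normL2, eLpNorm_congr_ae h1]
  exact eLpNorm_mono_measure _ Measure.restrict_le_self

end ZeroExt

/-! ### Translation between `H¹₀(Ω)` and its closed subspace of pairs -/

theorem MemH10.exists_pair (hΩ : MeasurableSet Ω) {u : Space N → ℝ} (hu : MemH10 Ω u) :
    ∃ x ∈ sobolevZero Ω, x.fst =ᵐ[volume.restrict Ω] u ∧
      x.snd =ᵐ[volume.restrict Ω] weakGradient Ω u := by
  obtain ⟨h1, φ, hφ, hl, hgl⟩ := hu
  have hg := h1.isWeakGradient.1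
  refine ⟨WithLp.toLp 2 (h1.1.extLp hΩ, hg.extLp hΩ), ?_, h1.1.extLp_ae_eq_restrict hΩ,
    hg.extLp_ae_eq_restrict hΩ⟩
  refine mem_closure_of_tendsto (b := atTop) (f := fun n => (hφ n).pair) ?_
    (Eventually.of_forall fun n => ⟨φ n, hφ n, rfl⟩)
  refine (WithLp.prod_continuous_toLp 2 _ _).continuousAt.tendsto.comp
    (Tendsto.prodMk_nhds ?_ ?_)
  · rw [Lp.tendsto_Lp_iff_tendsto_eLpNorm']
    refine hl.congr fun n => ?_
    rw [← eLpNorm_neg]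
    symm
    apply eLpNorm_eq_normL2 hΩ
    · filter_upwards [ae_restrict_of_ae (hφ n).memLp.coeFn_toLp,
        h1.1.extLp_ae_eq_restrict hΩ] with x e1 e2
      simp [e1, e2]
    · filter_upwards [(hφ n).memLp.coeFn_toLp, h1.1.extLp_ae_eq hΩ] with x e1 e2 hx
      simp [e1, e2, zeroExt, hx, (hφ n).eq_zero_of_notMem hx]
  · rw [Lp.tendsto_Lp_iff_tendsto_eLpNorm']
    refine hgl.congr fun n => ?_
    rw [← eLpNorm_neg]
    symm
    apply eLpNorm_eq_normL2 hΩ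
    · filter_upwards [ae_restrict_of_ae (hφ n).memLp_gradient.coeFn_toLp,
        hg.extLp_ae_eq_restrict hΩ] with x e1 e2
      simp [e1, e2]
    · filter_upwards [(hφ n).memLp_gradient.coeFn_toLp, hg.extLp_ae_eq hΩ] with x e1 e2 hx
      simp [e1, e2, zeroExt, hx, (hφ n).gradient_eq_zero_of_notMem hx]

theorem memH10_of_mem (hΩ : IsOpen Ω) {x : SobolevPair N} (hx : x ∈ sobolevZero Ω)  :
    MemH10 Ω x.fst ∧ weakGradient Ω x.fst =ᵐ[volume.restrict Ω] x.snd := by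
  have hH1 : MemH1 Ω x.fst := ⟨(Lp.memLp _).restrict _, _, isWeakGradient_of_mem hx Ω⟩
  have hg : weakGradient Ω x.fst =ᵐ[volume.restrict Ω] x.snd :=
    hH1.isWeakGradient.ae_eq hΩ (isWeakGradient_of_mem hx Ω)
  refine ⟨⟨hH1, ?_⟩, hg⟩
  obtain ⟨y, hy, hyx⟩ := mem_closure_iff_seq_limit.mp hx
  choose φ hφ hyφ using hy
  have h1 : Tendsto (fun n => (y n).fst) atTop (𝓝 x.fst) :=
    (SobolevPair.continuous_fst.tendsto x).comp hyx
  have h2 : Tendsto (fun n => (y n).snd) atTop (𝓝 x.snd) :=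
    (SobolevPair.continuous_snd.tendsto x).comp hyx
  rw [Lp.tendsto_Lp_iff_tendsto_eLpNorm'] at h1 h2
  refine ⟨φ, hφ, ?_, ?_⟩
  · refine tendsto_of_tendsto_of_tendsto_of_le_of_le tendsto_const_nhds h1
      (fun _ => zero_le) fun n => ?_
    refine le_trans (le_of_eq ?_) (eLpNorm_mono_measure _ (Measure.restrict_le_self (s := Ω)))
    rw [normL2, ← eLpNorm_neg]
    refine eLpNorm_congr_ae ?_
    filter_upwards [ae_restrict_of_ae (hφ n).memLp.coeFn_toLp] with a e
    have e' : (y n).fst a = φ n a := by rw [hyφ n]; exact e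
    simp [e']
  · refine tendsto_of_tendsto_of_tendsto_of_le_of_le tendsto_const_nhds h2
      (fun _ => zero_le) fun n => ?_
    refine le_trans (le_of_eq ?_) (eLpNorm_mono_measure _ (Measure.restrict_le_self (s := Ω)))
    rw [normL2, ← eLpNorm_neg]
    refine eLpNorm_congr_ae ?_
    filter_upwards [ae_restrict_of_ae (hφ n).memLp_gradient.coeFn_toLp, hg] with a e e2
    have e' : (y n).snd a = gradient (φ n) a := by rw [hyφ n]; exact e
    simp [e', e2]

/-! ### Dirichlet problems and the splitting of the Navier problem -/

/-- The Poincaré inequality on a bounded set. -/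
theorem norm_le_mul_norm_snd {R : ℝ} (hR : 0 ≤ R) (i : Fin N) {x : SobolevPair N}
    (hx : x ∈ sobolevZero (Metric.closedBall 0 R)) : ‖x‖ ≤ (2 * R + 1) * ‖x.snd‖ := by
  have h1 : ‖x.fst‖ ≤ 2 * R * ‖x.snd‖ :=
    sobolevZero_induction (p := fun x => ‖x.fst‖ ≤ 2 * R * ‖x.snd‖)
      (isClosed_le SobolevPair.continuous_fst.norm (SobolevPair.continuous_snd.norm.const_mul _))
      (fun φ hφ => hφ.norm_toLp_le i) hx
  -- Uses `(2R)² + 1 ≤ (2R + 1)²`.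
  refine abs_le_of_sq_le_sq' ?_ (by positivity) |>.2
  rw [WithLp.prod_norm_sq_eq_of_L2]
  have h2 := pow_le_pow_left₀ (norm_nonneg _) h1 2
  nlinarith [sq_nonneg ‖x.snd‖, mul_nonneg hR (sq_nonneg ‖x.snd‖)]

/-- Integration by parts in each coordinate; it links the variational form to the distributional
Laplacian. -/
theorem inner_snd_pair {x : SobolevPair N} (hx : x ∈ sobolevZero Ω') {ψ : Space N → ℝ}
    (hψ : IsTestFunction Ω ψ) :
    inner ℝ x.snd hψ.pair.snd = -∫ a in Ω, x.fst a * Laplacian.laplacian ψ a := by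
  have hint : ∀ i, Integrable (fun a => x.snd a i * gradient ψ a i) := fun i =>
    ((EuclideanSpace.proj (𝕜 := ℝ) i).comp_memLp' (Lp.memLp x.snd)).integrable_mul
      (hψ.partialDeriv i).memLp
  have hint' : ∀ i, Integrable (fun a => x.fst a * gradient (fun y => gradient ψ y i) a i) :=
    fun i => (Lp.memLp x.fst).integrable_mul ((hψ.partialDeriv i).partialDeriv i).memLp
  have h1 : inner ℝ x.snd hψ.pair.snd = ∑ i, ∫ a, x.snd a i * gradient ψ a i := by
    rw [← integral_finsetSum _ fun i _ => hint i]
    refine (inner_toLp x.snd hψ.memLp_gradient).trans ?_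
    congr 1
    ext a
    rw [PiLp.inner_apply]
    simp [mul_comm]
  have h2 : ∫ a in Ω, x.fst a * Laplacian.laplacian ψ a =
      ∑ i, ∫ a, x.fst a * gradient (fun y => gradient ψ y i) a i := by
    rw [← integral_finsetSum _ fun i _ => hint' i]
    simp only [hψ.laplacian_eq, Finset.mul_sum]
    refine setIntegral_eq_integral_of_forall_compl_eq_zero fun a ha => ?_
    refine Finset.sum_eq_zero fun i _ => ?_
    rw [((hψ.partialDeriv i).partialDeriv i).eq_zero_of_notMem ha, mul_zero]
  rw [h1, h2, ← Finset.sum_neg_distrib]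
  refine Finset.sum_congr rfl fun i _ => ?_
  rw [integral_fst_mul_gradient hx (hψ.partialDeriv i) i, neg_neg]

/-- The Dirichlet problem in the weak form `∫ ∇z·∇y = ∫ F.1 y + F.2·∇y`. -/
abbrev SolvesDirichlet (Ω : Set (Space N)) (F z : SobolevPair N) : Prop :=
  SolvesIn (WithLp.sndL 2 ℝ (Lp ℝ 2 (volume : Measure (Space N)))
    (Lp (Space N) 2 (volume : Measure (Space N)))) (sobolevZero Ω) F z

theorem inner_pair_fst (r : Lp ℝ 2 (volume : Measure (Space N))) {ψ : Space N → ℝ}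
    (hψ : IsTestFunction Ω ψ) :
    inner ℝ (WithLp.toLp 2 (-r, 0) : SobolevPair N) hψ.pair = -∫ a in Ω, r a * ψ a := by
  rw [WithLp.prod_inner_apply, hψ.setIntegral_mul_eq, ← inner_toLp_real r hψ.memLp]
  change inner ℝ (-r) _ + inner ℝ (0 : Lp (Space N) 2 (volume : Measure (Space N))) _ = _
  rw [inner_neg_left, inner_zero_left, add_zero]
  rfl

/-- For `x ∈ H¹₀(Ω)`, `Δx = r` in the distributional sense iff `x` is the variational solution of
the Dirichlet problem with right-hand side `-r`. -/
theorem solvesDirichlet_iff {x : SobolevPair N} (hx : x ∈ sobolevZero Ω)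
    (r : Lp ℝ 2 (volume : Measure (Space N))) :
    SolvesDirichlet Ω (WithLp.toLp 2 (-r, 0)) x ↔ IsWeakLaplacian Ω x.fst r := by
  constructor
  · intro h
    refine ⟨(Lp.memLp r).restrict _, fun ψ hψ => ?_⟩
    have h1 := h.2 hψ.pair hψ.pair_mem
    rw [inner_pair_fst] at h1
    have h2 := inner_snd_pair hx hψ
    exact neg_injective (h2.symm.trans h1)
  · intro h
    refine ⟨hx, fun y hy => ?_⟩
    refine sobolevZero_induction (p := fun y => inner ℝ x.snd y.snd =
      inner ℝ (WithLp.toLp 2 (-r, 0) : SobolevPair N) y) ?_ (fun ψ hψ => ?_) hy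
    · exact isClosed_eq (continuous_const.inner SobolevPair.continuous_snd) (by fun_prop)
    · rw [inner_pair_fst, inner_snd_pair hx hψ, h.2 ψ hψ]

theorem inner_eq_setIntegral {F : Type*} [NormedAddCommGroup F] [InnerProductSpace ℝ F]
    {a b : Lp F 2 (volume : Measure (Space N))} {v w : Space N → F}
    (ha : a =ᵐ[volume.restrict Ω] v) (hb : b =ᵐ[volume.restrict Ω] w)
    (h0 : ∀ᵐ x, x ∉ Ω → b x = 0) : inner ℝ a b = ∫ x in Ω, inner ℝ (v x) (w x) := by
  rw [L2.inner_def, ← setIntegral_eq_integral_of_ae_compl_eq_zero (s := Ω)]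
  · refine integral_congr_ae ?_
    filter_upwards [ha, hb] with x e1 e2
    rw [e1, e2]
  · filter_upwards [h0] with x hx hxΩ
    rw [hx hxΩ, inner_zero_right]

/-- The splitting of the Navier problem into two Dirichlet problems. -/
theorem IsNavierSolution.exists_split (hΩ : IsOpen Ω) {C : ℝ}
    (hC : ∀ x ∈ sobolevZero Ω, ‖x‖ ≤ C * ‖x.snd‖) {f u : Space N → ℝ} (hf : MemH1 Ω f)
    (hu : IsNavierSolution Ω f u) {fl : Lp ℝ 2 (volume : Measure (Space N))}
    {gl : Lp (Space N) 2 (volume : Measure (Space N))} (hfl : fl =ᵐ[volume.restrict Ω] f)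
    (hgl : gl =ᵐ[volume.restrict Ω] weakGradient Ω f) :
    ∃ z U : SobolevPair N, SolvesDirichlet Ω (WithLp.toLp 2 (0, -gl)) z ∧
      SolvesDirichlet Ω (WithLp.toLp 2 (-(fl + z.fst), 0)) U ∧
      U.fst =ᵐ[volume.restrict Ω] u ∧ U.snd =ᵐ[volume.restrict Ω] weakGradient Ω u ∧
      (fl + z.fst : Lp ℝ 2 (volume : Measure (Space N))) =ᵐ[volume.restrict Ω]
        weakLaplacian Ω u := by
  have hm := hΩ.measurableSet
  obtain ⟨hu1, hu2, hvar⟩ := hu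
  have hw := hu1.isWeakLaplacian
  obtain ⟨U, hU, hUu, hUg⟩ := hu2.exists_pair hm
  obtain ⟨z, hz⟩ := exists_solvesIn (WithLp.sndL 2 ℝ (Lp ℝ 2 (volume : Measure (Space N)))
    (Lp (Space N) 2 (volume : Measure (Space N)))) (sobolevZero Ω) (isClosed_sobolevZero Ω) C hC
    (WithLp.toLp 2 (0, -gl))
  let f₀ : Lp ℝ 2 (volume : Measure (Space N)) := hf.1.extLp hm
  let w₀ : Lp ℝ 2 (volume : Measure (Space N)) := hw.1.extLp hm
  have hw₀ : w₀ =ᵐ[volume.restrict Ω] weakLaplacian Ω u := hw.1.extLp_ae_eq_restrict hm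
  have hf₀ : f₀ =ᵐ[volume.restrict Ω] f := hf.1.extLp_ae_eq_restrict hm
  -- The defect to be shown zero. It is built from zero extensions, so it vanishes off `Ω` and its
  -- inner products over the whole space are integrals over `Ω`.
  let r : Lp ℝ 2 (volume : Measure (Space N)) := w₀ - f₀ - z.fst
  have hr0 : ∀ᵐ x, x ∉ Ω → r x = 0 := by
    filter_upwards [Lp.coeFn_sub (w₀ - f₀) z.fst, Lp.coeFn_sub w₀ f₀, hw.1.extLp_ae_eq hm,
      hf.1.extLp_ae_eq hm, fst_eq_zero_off hm hz.1] with x e1 e2 e3 e4 e5 hx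
    have e3' : w₀ x = 0 := by rw [e3, zeroExt, Set.indicator_of_notMem hx]
    have e4' : f₀ x = 0 := by rw [e4, zeroExt, Set.indicator_of_notMem hx]
    rw [e1, Pi.sub_apply, e2, Pi.sub_apply, e3', e4', e5 hx]
    simp
  -- The decisive test function: `Φ ∈ H¹₀(Ω)` with `ΔΦ = r`.
  obtain ⟨Φ, hΦ⟩ := exists_solvesIn (WithLp.sndL 2 ℝ (Lp ℝ 2 (volume : Measure (Space N)))
    (Lp (Space N) 2 (volume : Measure (Space N)))) (sobolevZero Ω) (isClosed_sobolevZero Ω) C hC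
    (WithLp.toLp 2 (-r, 0))
  have hΦΔ : IsWeakLaplacian Ω Φ.fst r := (solvesDirichlet_iff hΦ.1 r).mp hΦ
  obtain ⟨hΦ0, hΦg⟩ := memH10_of_mem hΩ hΦ.1
  have hΦH : MemHLaplacian Ω Φ.fst := ⟨hΦ0.1.1, _, hΦΔ⟩
  have hΦw : r =ᵐ[volume.restrict Ω] weakLaplacian Ω Φ.fst :=
    hΦΔ.ae_eq hΩ hΦH.isWeakLaplacian
  have hΦs0 := snd_eq_zero_off hm hΦ.1
  have hmain := hvar Φ.fst hΦH hΦ0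
  rw [integral_add] at hmain
  rotate_left
  · exact hf.1.integrable_mul hΦH.isWeakLaplacian.1
  · have hi : Integrable (fun x => inner ℝ (gl x) (Φ.snd x)) (volume.restrict Ω) :=
      (L2.integrable_inner gl Φ.snd).integrableOn
    refine hi.congr ?_
    filter_upwards [hgl, hΦg] with x e1 e2
    rw [e1, e2]
  have i1 : ∫ x in Ω, weakLaplacian Ω u x * weakLaplacian Ω Φ.fst x = inner ℝ w₀ r := by
    rw [inner_eq_setIntegral hw₀ hΦw hr0]
    simp [mul_comm]
  have i2 : ∫ x in Ω, f x * weakLaplacian Ω Φ.fst x = inner ℝ f₀ r := by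
    rw [inner_eq_setIntegral hf₀ hΦw hr0]
    simp [mul_comm]
  have i3 : ∫ x in Ω, inner ℝ (weakGradient Ω f x) (weakGradient Ω Φ.fst x) =
      inner ℝ gl Φ.snd := by
    rw [inner_eq_setIntegral hgl hΦg.symm hΦs0]
  rw [i1, i2, i3] at hmain
  have j1 : inner ℝ z.snd Φ.snd = -inner ℝ gl Φ.snd := by
    refine (hz.2 Φ hΦ.1).trans ?_
    rw [WithLp.prod_inner_apply]
    change inner ℝ (0 : Lp ℝ 2 (volume : Measure (Space N))) _ + inner ℝ (-gl) _ = _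
    rw [inner_zero_left, zero_add, inner_neg_left]
    rfl
  have j2 : inner ℝ Φ.snd z.snd = -inner ℝ r z.fst := by
    refine (hΦ.2 z hz.1).trans ?_
    rw [WithLp.prod_inner_apply]
    change inner ℝ (-r) _ + inner ℝ (0 : Lp (Space N) 2 (volume : Measure (Space N))) _ = _
    rw [inner_zero_left, add_zero, inner_neg_left]
    rfl
  -- Testing the equation of `z` with `Φ` and that of `Φ` with `z` turns `∫ ∇f·∇Φ` into `⟪r, z⟫`, so
  -- the Navier identity reads `⟪w₀ - f₀ - z, r⟫ = 0`.
  have hrr : inner ℝ r r = 0 := by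
    have e : inner ℝ r r = inner ℝ w₀ r - inner ℝ f₀ r - inner ℝ z.fst r := by
      rw [← inner_sub_left, ← inner_sub_left]
    rw [real_inner_comm] at j1
    have j3 : inner ℝ r z.fst = inner ℝ z.fst r := real_inner_comm _ _
    linarith
  have hr : w₀ - f₀ - z.fst = 0 := inner_self_eq_zero.mp hrr
  have hw₀' : w₀ = f₀ + z.fst := by rw [← sub_eq_zero, ← hr]; abel
  have hlap : (fl + z.fst : Lp ℝ 2 (volume : Measure (Space N))) =ᵐ[volume.restrict Ω]
      weakLaplacian Ω u := by
    filter_upwards [hw₀, hf₀, hfl, ae_restrict_of_ae (Lp.coeFn_add fl z.fst),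
      ae_restrict_of_ae (Lp.coeFn_add f₀ z.fst)] with x e1 e2 e3 e4 e5
    rw [← e1, hw₀', e4, e5, Pi.add_apply, Pi.add_apply, e2, e3]
  refine ⟨z, U, hz, ?_, hUu, hUg, hlap⟩
  exact (solvesDirichlet_iff hU _).mpr (hw.congr hUu.symm hlap.symm)

/-! ### Convergence under perturbation of the domain -/

/-- Under compact convergence to a stable set, weak limits of functions in `H¹₀(Ωε)` belong to
`H¹₀(Ω)`. -/
theorem CompactlyConverges.weak_limit_mem {Ωε : ℝ → Set (Space N)}
    (hconv : CompactlyConverges Ωε Ω) (hΩ : IsOpen Ω) (hΩε : ∀ ε, 0 < ε → IsOpen (Ωε ε))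
    (hstable : IsStable Ω) {U : Ultrafilter ℝ} (hU : (U : Filter ℝ) ≤ 𝓝[>] 0)
    {x : ℝ → SobolevPair N} (hx : ∀ᶠ ε in 𝓝[>] (0 : ℝ), x ε ∈ sobolevZero (Ωε ε))
    {x₀ : SobolevPair N} (hlim : ∀ y, Tendsto (fun ε => inner ℝ (x ε) y) U (𝓝 (inner ℝ x₀ y))) :
    x₀ ∈ sobolevZero Ω := by
  have hpos : ∀ᶠ ε in 𝓝[>] (0 : ℝ), 0 < ε := eventually_mem_nhdsWithin
  -- A closed subspace equals its double orthogonal complement, hence is weakly closed.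
  have hx₀ : x₀ ∈ sobolevZero Set.univ := by
    have := (isClosed_sobolevZero (Set.univ : Set (Space N))).completeSpace_coe
    rw [← Submodule.orthogonal_orthogonal (sobolevZero Set.univ), Submodule.mem_orthogonal]
    intro y hy
    rw [real_inner_comm]
    refine tendsto_nhds_unique (hlim y) (tendsto_const_nhds.congr' ?_)
    filter_upwards [hU hx] with ε hε
    exact ((Submodule.mem_orthogonal _ _).mp hy _
      (sobolevZero_mono (Set.subset_univ _) hε)).symm
  have hext : ∀ᵐ a, a ∉ closure Ω → x₀.fst a = 0 := by
    have h := (isClosed_closure (s := Ω)).isOpen_compl.ae_eq_zero_of_integral_contDiff_smul_eq_zero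
      (f := x₀.fst) (MemL2.locallyIntegrableOn isClosed_closure.isOpen_compl
        ((Lp.memLp x₀.fst).restrict _)) (fun φ h1 h2 h3 => by
      have hφ : IsTestFunction (closure Ω)ᶜ φ := ⟨h1, h2, h3⟩
      let y : SobolevPair N := WithLp.toLp 2 (hφ.memLp.toLp φ, 0)
      have hy : ∀ v : SobolevPair N, inner ℝ v y = ∫ a, v.fst a * φ a := fun v => by
        rw [← inner_toLp_real v.fst hφ.memLp, WithLp.prod_inner_apply]
        change _ + inner ℝ _ (0 : Lp (Space N) 2 (volume : Measure (Space N))) = _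
        rw [inner_zero_right, add_zero]
        rfl
      have e : ∀ a, φ a • x₀.fst a = x₀.fst a * φ a := fun a => by rw [smul_eq_mul, mul_comm]
      simp only [e]
      rw [← hy]
      -- For small `ε` the support of `φ` misses `Ωε ε`, where `x ε` lives, so the pairing is
      -- already zero.
      refine tendsto_nhds_unique (hlim y) (tendsto_const_nhds.congr' ?_)
      obtain ⟨ε₀, hε₀, hK⟩ := hconv.2 (tsupport φ) h2.isCompact h3
      have hsmall : ∀ᶠ ε in 𝓝[>] (0 : ℝ), ε < ε₀ :=
        eventually_nhdsWithin_of_eventually_nhds (eventually_lt_nhds hε₀)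
      filter_upwards [hU hx, hU hpos, hU hsmall] with ε h4 h5 h6
      rw [hy]
      symm
      refine integral_eq_zero_of_ae ?_
      filter_upwards [fst_eq_zero_off (hΩε ε h5).measurableSet h4] with a ha
      by_cases haφ : a ∈ tsupport φ
      · rw [ha fun h7 => hK ε h5 h6 haφ (subset_closure h7), zero_mul]; rfl
      · rw [image_eq_zero_of_notMem_tsupport haφ, mul_zero]; rfl)
    exact h
  have hm := hΩ.measurableSet
  have hgrad := isWeakGradient_of_mem hx₀ Set.univ
  obtain ⟨h0, hH10⟩ := hstable x₀.fst ⟨(Lp.memLp _).restrict _, _, hgrad⟩ hext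
  obtain ⟨x', hx', hfst, -⟩ := hH10.exists_pair hm
  have e1 : x'.fst = x₀.fst := by
    refine Lp.ext ?_
    filter_upwards [(ae_restrict_iff' hm).mp hfst, h0, fst_eq_zero_off hm hx'] with a h1 h2 h3
    by_cases ha : a ∈ Ω
    · exact h1 ha
    · rw [h2 ha, h3 ha]
  -- Stability concerns only the scalar component; uniqueness of the weak gradient on the whole
  -- space recovers the other one.
  have e2 : x'.snd = x₀.snd := by
    have h1 := isWeakGradient_of_mem hx' Set.univ
    rw [e1] at h1
    have h2 := h1.ae_eq isOpen_univ hgrad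
    rw [Measure.restrict_univ] at h2
    exact Lp.ext h2
  have e : x' = x₀ := WithLp.ofLp_injective _ (Prod.ext e1 e2)
  rwa [← e]

theorem tendsto_of_solvesDirichlet {R : ℝ} (hR : 0 ≤ R) (i : Fin N) {Ωε : ℝ → Set (Space N)}
    (hconv : CompactlyConverges Ωε Ω) (hΩ : IsOpen Ω) (hΩε : ∀ ε, 0 < ε → IsOpen (Ωε ε))
    (hΩR : Ω ⊆ Metric.closedBall 0 R) (hΩεR : ∀ ε, 0 < ε → Ωε ε ⊆ Metric.closedBall 0 R)
    (hstable : IsStable Ω) {F z : SobolevPair N} {Fε zε : ℝ → SobolevPair N}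
    (hF : Tendsto Fε (𝓝[>] 0) (𝓝 F)) (hz : SolvesDirichlet Ω F z)
    (hzε : ∀ ε, 0 < ε → SolvesDirichlet (Ωε ε) (Fε ε) (zε ε)) :
    Tendsto zε (𝓝[>] 0) (𝓝 z) := by
  have hpos : ∀ᶠ ε in 𝓝[>] (0 : ℝ), 0 < ε := eventually_mem_nhdsWithin
  refine tendsto_of_solvesIn _ (sobolevZero Ω) (sobolevZero (Metric.closedBall 0 R))
    (fun ε => sobolevZero (Ωε ε)) (2 * R + 1) (fun x hx => norm_le_mul_norm_snd hR i hx)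
    (sobolevZero_mono hΩR) (hpos.mono fun ε h => sobolevZero_mono (hΩεR ε h))
    (testPairs Ω : Set (SobolevPair N)) subset_rfl ?_ ?_ hF hz (hpos.mono hzε)
  · rintro _ ⟨φ, hφ, rfl⟩
    obtain ⟨ε₀, hε₀, hK⟩ := hconv.1 (tsupport φ) hφ.2.1.isCompact hφ.2.2
    have hsmall : ∀ᶠ ε in 𝓝[>] (0 : ℝ), ε < ε₀ :=
      eventually_nhdsWithin_of_eventually_nhds (eventually_lt_nhds hε₀)
    filter_upwards [hpos, hsmall] with ε h1 h2
    exact (hφ.of_tsupport (hK ε h1 h2)).pair_mem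
  · intro U hU x hx x₀ hlim
    exact hconv.weak_limit_mem hΩ hΩε hstable hU hx hlim

/-- `L²` functions on `Ωε` converging to the zero extension of a function on `Ω` are restrictions
of a family converging in `L²(ℝ^N)`. -/
theorem exists_tendsto_extension {F : Type*} [NormedAddCommGroup F] {Ωε : ℝ → Set (Space N)}
    (hΩ : MeasurableSet Ω) (hΩε : ∀ ε, 0 < ε → MeasurableSet (Ωε ε)) {v : Space N → F}
    {vε : ℝ → Space N → F} (hv : MemL2 Ω v) (hvε : ∀ ε, 0 < ε → MemL2 (Ωε ε) (vε ε))
    (hlim : Tendsto (fun ε => normL2 (Ωε ε) (fun x => vε ε x - zeroExt Ω v x)) (𝓝[>] 0) (𝓝 0)) :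
    ∃ a : ℝ → Lp F 2 (volume : Measure (Space N)), Tendsto a (𝓝[>] 0) (𝓝 (hv.extLp hΩ)) ∧
      ∀ ε, 0 < ε → a ε =ᵐ[volume.restrict (Ωε ε)] vε ε := by
  have hd : ∀ ε, 0 < ε → MemL2 (Ωε ε) (fun x => vε ε x - zeroExt Ω v x) := fun ε hε =>
    (hvε ε hε).sub ((hv.memLp_zeroExt hΩ).restrict _)
  have hex : ∀ ε : ℝ, ∃ d : Lp F 2 (volume : Measure (Space N)), ∀ hε : 0 < ε,
      d = (hd ε hε).extLp (hΩε ε hε) := fun ε => by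
    by_cases hε : 0 < ε
    · exact ⟨(hd ε hε).extLp (hΩε ε hε), fun _ => rfl⟩
    · exact ⟨0, fun h => absurd h hε⟩
  choose d hd' using hex
  -- Off `Ωε ε` the extension equals `v₀` instead of zero, so its distance to `v₀` is exactly the
  -- norm in `hlim`.
  refine ⟨fun ε => hv.extLp hΩ + d ε, ?_, fun ε hε => ?_⟩
  · have h0 : Tendsto d (𝓝[>] 0) (𝓝 0) := by
      rw [Lp.tendsto_Lp_iff_tendsto_eLpNorm']
      refine hlim.congr' ?_
      filter_upwards [eventually_mem_nhdsWithin] with ε hε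
      have hm := hΩε ε hε
      symm
      apply eLpNorm_eq_normL2 hm
      · rw [hd' ε hε]
        filter_upwards [(hd ε hε).extLp_ae_eq_restrict hm,
          ae_restrict_of_ae (Lp.coeFn_zero F 2 (volume : Measure (Space N)))] with x e1 e2
        rw [Pi.sub_apply, e1, e2]
        simp
      · rw [hd' ε hε]
        filter_upwards [(hd ε hε).extLp_ae_eq hm,
          Lp.coeFn_zero F 2 (volume : Measure (Space N))] with x e1 e2 hx
        rw [Pi.sub_apply, e1, e2, zeroExt, Set.indicator_of_notMem hx]
        simp
    simpa using tendsto_const_nhds.add h0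
  · beta_reduce
    rw [hd' ε hε]
    filter_upwards [(hd ε hε).extLp_ae_eq_restrict (hΩε ε hε),
      ae_restrict_of_ae (hv.extLp_ae_eq hΩ), ae_restrict_of_ae
      (Lp.coeFn_add (hv.extLp hΩ) ((hd ε hε).extLp (hΩε ε hε)))] with x e1 e2 e3
    rw [e3, Pi.add_apply, e1, e2]
    abel

end NavierProblem

end

open NavierProblem in
theorem theorem5p3 (N : ℕ) (hN : 1 ≤ N)
    (D : Set (Space N)) (hD : Bornology.IsBounded D)
    (Ω : Set (Space N)) (Ωε : ℝ → Set (Space N))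
    (hΩ : IsDomainSet Ω) (hΩD : Ω ⊆ D)
    (hΩε : ∀ ε, 0 < ε → IsDomainSet (Ωε ε)) (hΩεD : ∀ ε, 0 < ε → Ωε ε ⊆ D)
    (hconv : CompactlyConverges Ωε Ω) (hstable : IsStable Ω)
    (f : Space N → ℝ) (fε : ℝ → Space N → ℝ)
    (hf : MemH1 Ω f) (hfε : ∀ ε, 0 < ε → MemH1 (Ωε ε) (fε ε))
    (hf_lim : Tendsto (fun ε => normL2 (Ωε ε) (fun x => fε ε x - zeroExt Ω f x))
      (𝓝[>] 0) (𝓝 0))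
    (hgradf_lim : Tendsto (fun ε => normL2 (Ωε ε) (fun x =>
      weakGradient (Ωε ε) (fε ε) x - zeroExt Ω (weakGradient Ω f) x)) (𝓝[>] 0) (𝓝 0))
    (u : Space N → ℝ) (uε : ℝ → Space N → ℝ)
    (hu : IsNavierSolution Ω f u)
    (huε : ∀ ε, 0 < ε → IsNavierSolution (Ωε ε) (fε ε) (uε ε)) :
    Tendsto (fun ε => normL2 (Ωε ε) (fun x => uε ε x - zeroExt Ω u x)) (𝓝[>] 0) (𝓝 0) ∧
    Tendsto (fun ε => normL2 (Ωε ε) (fun x =>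
      weakGradient (Ωε ε) (uε ε) x - zeroExt Ω (weakGradient Ω u) x)) (𝓝[>] 0) (𝓝 0) ∧
    Tendsto (fun ε => normL2 (Ωε ε) (fun x =>
      weakLaplacian (Ωε ε) (uε ε) x - zeroExt Ω (weakLaplacian Ω u) x)) (𝓝[>] 0) (𝓝 0) := by
  obtain ⟨R, hR, hDR⟩ : ∃ R : ℝ, 0 ≤ R ∧ D ⊆ Metric.closedBall 0 R := by
    obtain ⟨R, hR⟩ := hD.subset_closedBall 0
    exact ⟨max R 0, le_max_right _ _,
      hR.trans (Metric.closedBall_subset_closedBall (le_max_left _ _))⟩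
  -- The coordinate direction in which Poincaré's inequality is applied.
  have i : Fin N := ⟨0, hN⟩
  have hΩR := hΩD.trans hDR
  have hΩεR := fun ε hε => (hΩεD ε hε).trans hDR
  have hΩεo := fun ε hε => (hΩε ε hε).1
  have hm := hΩ.1.measurableSet
  have hpos : ∀ᶠ ε in 𝓝[>] (0 : ℝ), 0 < ε := eventually_mem_nhdsWithin
  have hpoin : ∀ {Ω' : Set (Space N)}, Ω' ⊆ Metric.closedBall 0 R →
      ∀ x ∈ sobolevZero Ω', ‖x‖ ≤ (2 * R + 1) * ‖x.snd‖ := fun h x hx =>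
    norm_le_mul_norm_snd hR i (sobolevZero_mono h hx)
  have hg := hf.isWeakGradient.1
  obtain ⟨fl, hfl, hfl'⟩ := exists_tendsto_extension hm (fun ε hε => (hΩεo ε hε).measurableSet)
    hf.1 (fun ε hε => (hfε ε hε).1) hf_lim
  obtain ⟨gl, hgl, hgl'⟩ := exists_tendsto_extension hm (fun ε hε => (hΩεo ε hε).measurableSet)
    hg (fun ε hε => (hfε ε hε).isWeakGradient.1) hgradf_lim
  obtain ⟨z, U, hz, hU, hUu, hUg, hUl⟩ := hu.exists_split hΩ.1 (hpoin hΩR) hf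
    (hf.1.extLp_ae_eq_restrict hm) (hg.extLp_ae_eq_restrict hm)
  have hsplit := fun (ε : ℝ) (hε : 0 < ε) => (huε ε hε).exists_split (hΩεo ε hε)
    (hpoin (hΩεR ε hε)) (hfε ε hε) (hfl' ε hε) (hgl' ε hε)
  choose! zε Uε hzε hUε hUεu hUεg hUεl using hsplit
  have hzlim : Tendsto zε (𝓝[>] 0) (𝓝 z) :=
    tendsto_of_solvesDirichlet hR i hconv hΩ.1 hΩεo hΩR hΩεR hstable
      ((WithLp.prod_continuous_toLp 2 _ _).continuousAt.tendsto.comp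
        (tendsto_const_nhds.prodMk_nhds hgl.neg)) hz hzε
  -- This sum represents `Δuε`: its convergence is both the third claim and the convergence of the
  -- data of the second Dirichlet problem.
  have hwlim : Tendsto (fun ε => fl ε + (zε ε).fst) (𝓝[>] 0) (𝓝 (hf.1.extLp hm + z.fst)) :=
    hfl.add ((SobolevPair.continuous_fst.tendsto z).comp hzlim)
  have hUlim : Tendsto Uε (𝓝[>] 0) (𝓝 U) :=
    tendsto_of_solvesDirichlet hR i hconv hΩ.1 hΩεo hΩR hΩεR hstable
      ((WithLp.prod_continuous_toLp 2 _ _).continuousAt.tendsto.comp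
        (hwlim.neg.prodMk_nhds tendsto_const_nhds)) hU hUε
  refine ⟨?_, ?_, ?_⟩
  · exact tendsto_normL2_of_tendsto_Lp hm ((SobolevPair.continuous_fst.tendsto U).comp hUlim)
      (hpos.mono hUεu) hUu (fst_eq_zero_off hm hU.1)
  · exact tendsto_normL2_of_tendsto_Lp hm ((SobolevPair.continuous_snd.tendsto U).comp hUlim)
      (hpos.mono hUεg) hUg (snd_eq_zero_off hm hU.1)
  · refine tendsto_normL2_of_tendsto_Lp hm hwlim (hpos.mono hUεl) hUl ?_
    filter_upwards [Lp.coeFn_add (hf.1.extLp hm) z.fst, hf.1.extLp_ae_eq hm,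
      fst_eq_zero_off hm hz.1] with x e1 e2 e3 hx
    rw [e1, Pi.add_apply, e2, e3 hx, zeroExt, Set.indicator_of_notMem hx, add_zero]
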